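/- Let $n \ge 4$, let $\lambda_3, \ldots, \lambda_{n-1} \in \mathbb{R}$, $\alpha \le 0$ and $\beta > 0$, and let $g$ be the metric on $\mathbb{R}^n$ given in the canonical coordinates $x_1, \ldots, x_n$ by $$ds^{2} = e^{-2\alpha x_{n}} \left[ \cos(2\beta x_{n})(-dx_{1}^{2} + dx_{2}^{2}) - 2\sin(2\beta x_{n})\,dx_{1}\, dx_{2} \right] + \sum_{i = 3}^{n-1} e^{-2\lambda_{i} x_{n}} dx_{i}^{2} + dx_{n}^{2}.$$ Then $g$ is a (smooth) Lorentzian metric of signature $(-,+,\ldots,+)$, it is homogeneous (its isometry group acts transitively on $\mathbb{R}^n$), and $(\mathbb{R}^n, g)$ is geodesically complete: every geodesic of its Levi-Civita connection, defined on an open interval, extends to a geodesic defined on all of $\mathbb{R}$. -/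

import Mathlib

open scoped Matrix ContDiff

/-- The value `g(v, w) = ∑ i j, v i * M i j * w j` of the bilinear form with Gram matrix `M`. -/
def bilin {n : ℕ} (M : Matrix (Fin n) (Fin n) ℝ) (v w : Fin n → ℝ) : ℝ := v ⬝ᵥ (M *ᵥ w)

/-- `g`, given by its components `g x i j` in the canonical coordinates of `ℝⁿ`, is a Lorentzian
metric: the components are smooth and symmetric, and at every point there is a basis of the tangent
space (the columns of `P`) that is orthonormal with exactly one timelike vector, so that the
signature is `(-, +, …, +)`. -/
structure IsLorentzianMetric {n : ℕ} (g : (Fin n → ℝ) → Matrix (Fin n) (Fin n) ℝ) : Prop where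
  smooth : ∀ i j, ContDiff ℝ ∞ (fun x => g x i j)
  symm : ∀ x, (g x).IsSymm
  signature : ∀ x, ∃ (P : Matrix (Fin n) (Fin n) ℝ) (i₀ : Fin n), IsUnit P.det ∧
    Pᵀ * g x * P = Matrix.diagonal (fun i => if i = i₀ then -1 else 1)

/-- The diffeomorphism `φ` of `ℝⁿ` is an isometry of `g`. -/
structure IsMetricIsometry {n : ℕ} (g : (Fin n → ℝ) → Matrix (Fin n) (Fin n) ℝ)
    (φ : (Fin n → ℝ) ≃ (Fin n → ℝ)) : Prop where
  smooth : ContDiff ℝ ∞ φ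
  smooth_symm : ContDiff ℝ ∞ φ.symm
  map_metric : ∀ x v w,
    bilin (g (φ x)) (fderiv ℝ φ x v) (fderiv ℝ φ x w) = bilin (g x) v w

/-- The isometry group of `g` acts transitively on `ℝⁿ`. -/
def IsHomogeneousMetric {n : ℕ} (g : (Fin n → ℝ) → Matrix (Fin n) (Fin n) ℝ) : Prop :=
  ∀ p q : Fin n → ℝ, ∃ φ : (Fin n → ℝ) ≃ (Fin n → ℝ), IsMetricIsometry g φ ∧ φ p = q

/-- The partial derivative `∂ₖ f` at `x`. -/
noncomputable def partialDeriv {n : ℕ} (k : Fin n) (f : (Fin n → ℝ) → ℝ) (x : Fin n → ℝ) : ℝ :=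
  fderiv ℝ f x (Pi.single k 1)

/-- The Christoffel symbols `Γᵏᵢⱼ = ½ ∑ₗ gᵏˡ (∂ᵢ gⱼₗ + ∂ⱼ gᵢₗ - ∂ₗ gᵢⱼ)` of the Levi-Civita
connection of `g`. -/
noncomputable def christoffel {n : ℕ} (g : (Fin n → ℝ) → Matrix (Fin n) (Fin n) ℝ)
    (x : Fin n → ℝ) (k i j : Fin n) : ℝ :=
  (1 / 2) * ∑ l, (g x)⁻¹ k l *
    (partialDeriv i (fun y => g y j l) x + partialDeriv j (fun y => g y i l) x
      - partialDeriv l (fun y => g y i j) x)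

/-- The curve `γ` is twice differentiable on the open set `I` and satisfies there the geodesic
equation `γₖ'' + ∑ᵢⱼ Γᵏᵢⱼ(γ) γᵢ' γⱼ' = 0` (for a smooth metric it is then smooth on `I`). Only the
values of `γ` on `I` matter. -/
def IsGeodesicOn {n : ℕ} (g : (Fin n → ℝ) → Matrix (Fin n) (Fin n) ℝ)
    (γ : ℝ → Fin n → ℝ) (I : Set ℝ) : Prop :=
  ∀ t ∈ I, DifferentiableAt ℝ γ t ∧
    HasDerivAt (deriv γ)
      (fun k => -∑ i, ∑ j, christoffel g (γ t) k i j * deriv γ t i * deriv γ t j) t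

/-- Every geodesic, defined on any open interval `I`, extends to a geodesic defined on all
of `ℝ`. -/
def IsGeodesicallyComplete {n : ℕ} (g : (Fin n → ℝ) → Matrix (Fin n) (Fin n) ℝ) : Prop :=
  ∀ (I : Set ℝ) (γ : ℝ → Fin n → ℝ), IsOpen I → I.OrdConnected → IsGeodesicOn g γ I →
    ∃ η : ℝ → Fin n → ℝ, IsGeodesicOn g η Set.univ ∧ Set.EqOn η γ I

/-- The components of the metric on `ℝⁿ`, `n = m + 4`,
`e^{-2αxₙ} [cos(2βxₙ) (-dx₁² + dx₂²) - 2 sin(2βxₙ) dx₁ dx₂] + ∑ᵢ e^{-2λᵢxₙ} dxᵢ² + dxₙ²`,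
the sum being over `3 ≤ i ≤ n - 1`. The coordinate `xᵢ` is `x (i - 1)`, so `xₙ` is
`x (Fin.last (m + 3))`, and `λᵢ` is `lam (i - 3)`. -/
noncomputable def petrovMetric {m : ℕ} (α β : ℝ) (lam : Fin (m + 1) → ℝ)
    (x : Fin (m + 4) → ℝ) : Matrix (Fin (m + 4)) (Fin (m + 4)) ℝ :=
  let s : ℝ := x (Fin.last (m + 3))
  let c : ℝ := Real.exp (-2 * α * s) * Real.cos (2 * β * s)
  let d : ℝ := Real.exp (-2 * α * s) * Real.sin (2 * β * s)
  Matrix.diagonal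
      (Fin.snoc (α := fun _ => ℝ)
        (Matrix.vecCons (-c) (Matrix.vecCons c (fun k => Real.exp (-2 * lam k * s)))) 1)
    + Matrix.single 0 1 (-d) + Matrix.single 1 0 (-d)

/-- The quadratic form of `petrovMetric` is the line element displayed in its description. -/
theorem petrovMetric_lineElement {m : ℕ} (α β : ℝ) (lam : Fin (m + 1) → ℝ)
    (x v : Fin (m + 4) → ℝ) :
    bilin (petrovMetric α β lam x) v v =
      Real.exp (-2 * α * x (Fin.last (m + 3))) *
        (Real.cos (2 * β * x (Fin.last (m + 3))) * (-(v 0) ^ 2 + (v 1) ^ 2)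
          - 2 * Real.sin (2 * β * x (Fin.last (m + 3))) * v 0 * v 1)
      + ∑ k : Fin (m + 1),
          Real.exp (-2 * lam k * x (Fin.last (m + 3))) * (v k.succ.succ.castSucc) ^ 2
      + (v (Fin.last (m + 3))) ^ 2 := by
  have h0 : ((0 : Fin (m + 3)).castSucc : Fin (m + 4)) = 0 := rfl
  have h1 : ((Fin.succ (0 : Fin (m + 2))).castSucc : Fin (m + 4)) = 1 := rfl
  have hd : ∀ a : Fin (m + 4) → ℝ, v ⬝ᵥ (Matrix.diagonal a *ᵥ v) = ∑ i, a i * v i ^ 2 := by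
    intro a
    simp only [dotProduct, Matrix.mulVec_diagonal]
    exact Finset.sum_congr rfl fun i _ => by ring
  have hs : ∀ (i : Fin (m + 4)) (r : ℝ), v ⬝ᵥ Function.update 0 i r = v i * r :=
    fun i r => dotProduct_single v r i
  simp only [bilin, petrovMetric, Matrix.add_mulVec, dotProduct_add, hd, Matrix.single_mulVec]
  rw [Fin.sum_univ_castSucc, Fin.sum_univ_succ, Fin.sum_univ_succ]
  simp only [Fin.snoc_castSucc, Fin.snoc_last, Matrix.cons_val_succ, h0, h1]
  simp [hs]
  ring

/-!
Put `s = xₙ` and `z = x₁ + i x₂`. The metric is `h_s + ds²`, where `h_s` has constant coefficients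
on each slice, and its first block is `-Re (e^{-2(α + iβ)s} dz²)`. Hence the maps
`s ↦ s + a`, `z ↦ e^{(α + iβ)a} z`, `xᵢ ↦ e^{λᵢ a} xᵢ` are isometries
(`petrovFlow_transpose_mul_mul`); together with the translations of the slices they act
transitively, and they carry the obvious orthonormal basis at `s = 0` to one at every `s`.

For completeness, the Euler-Lagrange equations (`IsOneVariableMetric.hasDerivAt_momentum`) show that
the momenta `pᵢ = ∑ⱼ hᵢⱼ(s) xⱼ'`, `i < n`, of a geodesic are constant, and that `s` satisfies
Newton's equation `s'' = -V'(s) / 2` with the potential `V(s) = ∑ᵢⱼ hⁱʲ(s) pᵢ pⱼ`. Conversely, a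
solution `s` of this equation gives a geodesic by integrating `x' = h_s⁻¹ p`. It remains to see
that the solutions of Newton's equation are global. The energy `s' ^ 2 + V(s)` is conserved, so that
`s'` is bounded wherever `V` is bounded below. Here `V` is a sum of nonnegative terms and of the
oscillation `e^{2αs} (A cos 2βs - B sin 2βs)` (`bilin_petrovComponents`). If `α = 0` or
`A = B = 0`, then `V` is bounded below. If `α < 0` and the oscillation does not vanish, it is
bounded on every half-line `[M, ∞)`, while its peaks grow without bound as `s → -∞`, so that one of
them is a barrier to the left of the starting point that the given energy cannot pass
(`isConfining_petrov`).
-/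

/-! ### Global solutions of autonomous differential equations -/

section ODE

open Set Metric
open scoped Manifold NNReal

variable {E : Type*} [NormedAddCommGroup E] [NormedSpace ℝ E]

/-- On an open subset of the line, integral curves of a vector field on a vector space, seen as a
manifold, are solutions of the differential equation. -/
theorem isMIntegralCurveOn_iff_hasDerivAt {f : E → E} {γ : ℝ → E} {s : Set ℝ} (hs : IsOpen s) :
    IsMIntegralCurveOn (I := 𝓘(ℝ, E)) γ f s ↔ ∀ t ∈ s, HasDerivAt γ (f (γ t)) t := by
  refine forall₂_congr fun t ht => ?_
  refine (hasMFDerivWithinAt_iff_hasFDerivWithinAt (f := γ)).trans ?_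
  exact ⟨fun h => h.hasFDerivAt (hs.mem_nhds ht), fun h => h.hasFDerivAt.hasFDerivWithinAt⟩

/-- Two solutions of an autonomous `C¹` equation on an open interval agree if they agree at one
time. -/
theorem eqOn_of_hasDerivAt_of_contDiff [CompleteSpace E] {f : E → E} (hf : ContDiff ℝ 1 f)
    {I : Set ℝ} (hIo : IsOpen I) (hIc : I.OrdConnected) {γ η : ℝ → E}
    (hγ : ∀ t ∈ I, HasDerivAt γ (f (γ t)) t) (hη : ∀ t ∈ I, HasDerivAt η (f (η t)) t)
    {t₀ : ℝ} (ht₀ : t₀ ∈ I) (h : γ t₀ = η t₀) : EqOn γ η I := by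
  intro t ht
  have key : ∀ x ∈ I, ∃ r > 0, x - r ∈ I ∧ x + r ∈ I := by
    intro x hx
    obtain ⟨ε, hε, hε'⟩ := Metric.isOpen_iff.1 hIo _ hx
    refine ⟨ε / 2, by positivity, hε' ?_, hε' ?_⟩ <;>
      simp [abs_of_pos hε, hε]
  obtain ⟨r, hr, hr1, hr2⟩ := key t ht
  obtain ⟨r', hr', hr1', hr2'⟩ := key t₀ ht₀
  have hmin : min (t - r) (t₀ - r') ∈ I := by
    rcases min_choice (t - r) (t₀ - r') with h | h <;> rwa [h]
  have hmax : max (t + r) (t₀ + r') ∈ I := by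
    rcases max_choice (t + r) (t₀ + r') with h | h <;> rwa [h]
  have hsub : Ioo (min (t - r) (t₀ - r')) (max (t + r) (t₀ + r')) ⊆ I :=
    Ioo_subset_Icc_self.trans (hIc.out hmin hmax)
  refine isMIntegralCurveOn_Ioo_eqOn_of_contMDiff_boundaryless (I := 𝓘(ℝ, E)) (t₀ := t₀) (v := f)
    (a := min (t - r) (t₀ - r')) (b := max (t + r) (t₀ + r')) ?_ ?_ ?_ ?_ h ?_
  · exact ⟨(min_le_right _ _).trans_lt (by linarith),
      lt_of_lt_of_le (by linarith) (le_max_right _ _)⟩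
  · exact contMDiff_vectorSpace_iff_contDiff.2 hf
  · exact (isMIntegralCurveOn_iff_hasDerivAt isOpen_Ioo).2 fun x hx => hγ x (hsub hx)
  · exact (isMIntegralCurveOn_iff_hasDerivAt isOpen_Ioo).2 fun x hx => hη x (hsub hx)
  · exact ⟨(min_le_left _ _).trans_lt (by linarith), lt_of_lt_of_le (by linarith) (le_max_left _ _)⟩

/-- A `C¹` vector field with compact support has integral curves on every bounded interval. -/
theorem exists_hasDerivAt_Ioo_of_hasCompactSupport [CompleteSpace E] {f : E → E}
    (hf : ContDiff ℝ 1 f) (hc : HasCompactSupport f) (y₀ : E) {T : ℝ} (hT : 0 ≤ T) :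
    ∃ y : ℝ → E, y 0 = y₀ ∧ ∀ t ∈ Ioo (-T) T, HasDerivAt y (f (y t)) t := by
  obtain ⟨K, hK⟩ := ContDiff.lipschitzWith_of_hasCompactSupport hc hf one_ne_zero
  obtain ⟨C, hC⟩ := hc.exists_bound_of_continuous hf.continuous
  have h0 : (0 : ℝ) ∈ Icc (-T) T := ⟨by linarith, hT⟩
  lift C to ℝ≥0 using (norm_nonneg _).trans (hC 0)
  lift T to ℝ≥0 using hT
  have hP : IsPicardLindelof (fun _ => f) (tmin := -T) (tmax := T) ⟨0, h0⟩ y₀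
      (C * T) 0 C K := by
    refine IsPicardLindelof.of_time_independent (fun x _ => hC x) hK.lipschitzOnWith ?_
    simp
  obtain ⟨y, hy, hy'⟩ := hP.exists_eq_forall_mem_Icc_hasDerivWithinAt₀
  exact ⟨y, hy, fun t ht => (hy' t (Ioo_subset_Icc_self ht)).hasDerivAt (Icc_mem_nhds ht.1 ht.2)⟩

/-- An autonomous `C¹` equation has a global solution as soon as its solutions obey an a priori
bound on every bounded time interval. -/
theorem exists_global_solution_of_bound [FiniteDimensional ℝ E]
    {f : E → E} (hf : ContDiff ℝ 1 f) (y₀ : E)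
    (hb : ∀ T : ℝ, 0 < T → ∃ R : ℝ, ∀ y : ℝ → E, y 0 = y₀ → ∀ τ, 0 ≤ τ → τ < T →
      (∀ t ∈ Icc (-τ) τ, HasDerivAt y (f (y t)) t) → ∀ t ∈ Icc (-τ) τ, ‖y t‖ < R) :
    ∃ y : ℝ → E, y 0 = y₀ ∧ ∀ t, HasDerivAt y (f (y t)) t := by
  have : CompleteSpace E := FiniteDimensional.complete ℝ E
  suffices h : ∀ a : ℝ, ∃ y : ℝ → E, y 0 = y₀ ∧
      IsMIntegralCurveOn (I := 𝓘(ℝ, E)) y f (Ioo (-a) a) by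
    obtain ⟨y, hy, hy'⟩ := (exists_isMIntegralCurve_iff_exists_isMIntegralCurveOn_Ioo
      (I := 𝓘(ℝ, E)) (v := f) (contMDiff_vectorSpace_iff_contDiff.2 hf) y₀).2 h
    refine ⟨y, hy, fun t => ?_⟩
    exact (isMIntegralCurveOn_iff_hasDerivAt isOpen_univ).1 (hy'.isMIntegralCurveOn univ) t trivial
  intro T
  rcases le_or_gt T 0 with hT | hT
  · exact ⟨fun _ => y₀, rfl, by rw [Ioo_eq_empty (by linarith)]; exact fun t ht => ht.elim⟩
  obtain ⟨R₀, hR₀⟩ := hb T hT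
  -- Cut the vector field off outside a ball that the a priori bound does not allow to leave.
  set R : ℝ := max R₀ (‖y₀‖ + 1)
  have hR : ∀ y : ℝ → E, y 0 = y₀ → ∀ τ, 0 ≤ τ → τ < T →
      (∀ t ∈ Icc (-τ) τ, HasDerivAt y (f (y t)) t) → ∀ t ∈ Icc (-τ) τ, ‖y t‖ < R :=
    fun y hy τ h1 h2 h3 t ht => (hR₀ y hy τ h1 h2 h3 t ht).trans_le (le_max_left _ _)
  have hRpos : 0 < R := lt_of_lt_of_le (by positivity) (le_max_right _ _)
  let χ : ContDiffBump (0 : E) := ⟨R, R + 1, hRpos, by linarith⟩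
  obtain ⟨y, hy, hy'⟩ := exists_hasDerivAt_Ioo_of_hasCompactSupport (f := fun x => χ x • f x)
    (χ.contDiff.smul hf) χ.hasCompactSupport.smul_right y₀ hT.le
  have hcut : ∀ t ∈ Ioo (-T) T, ‖y t‖ ≤ R → HasDerivAt y (f (y t)) t := by
    intro t ht h
    have h1 := χ.one_of_mem_closedBall (x := y t) (by simpa [χ] using h)
    simpa [h1] using hy' t ht
  refine ⟨y, hy, (isMIntegralCurveOn_iff_hasDerivAt isOpen_Ioo).2 fun t ht => hcut t ht ?_⟩
  by_contra! hlt
  have hcont : ContinuousOn y (Ioo (-T) T) := fun s hs => (hy' s hs).continuousAt.continuousWithinAt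
  have hsub : Icc (-|t|) |t| ⊆ Ioo (-T) T := by
    have := abs_lt.2 ht
    exact fun s hs => ⟨by linarith [hs.1], by linarith [hs.2]⟩
  -- A time of smallest modulus at which the truncated solution is on or outside the sphere.
  obtain ⟨s, ⟨hs, hsR⟩, hmin⟩ : ∃ s ∈ Icc (-|t|) |t| ∩ (fun s => ‖y s‖) ⁻¹' Ici R,
      IsMinOn (fun s : ℝ => |s|) (Icc (-|t|) |t| ∩ (fun s => ‖y s‖) ⁻¹' Ici R) s := by
    have hcomp : IsCompact (Icc (-|t|) |t| ∩ (fun s => ‖y s‖) ⁻¹' Ici R) := by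
      refine isCompact_Icc.of_isClosed_subset ?_ inter_subset_left
      exact ((hcont.mono hsub).norm).preimage_isClosed_of_isClosed isClosed_Icc isClosed_Ici
    exact hcomp.exists_isMinOn ⟨t, ⟨⟨neg_abs_le t, le_abs_self t⟩, hlt.le⟩⟩
      continuous_abs.continuousOn
  have hsT : |s| < T := (abs_le.2 hs).trans_lt (abs_lt.2 ht)
  have hin : ∀ u ∈ Ioo (-|s|) |s|, ‖y u‖ ≤ R := by
    intro u hu
    by_contra! h
    have hu' := abs_lt.2 hu
    have hst := abs_le.2 hs
    exact absurd (hmin ⟨abs_le.1 (hu'.le.trans hst), h.le⟩) (not_le.2 hu')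
  have h0 : ‖y 0‖ < R := hy ▸ (lt_add_one _).trans_le (le_max_right _ _)
  have hs0 : s ≠ 0 := by
    rintro rfl
    exact absurd h0 (not_lt.2 hsR)
  have hle : ∀ u ∈ Icc (-|s|) |s|, ‖y u‖ ≤ R := by
    have hpos := abs_pos.2 hs0
    rw [← closure_Ioo (by linarith : -|s| ≠ |s|)]
    refine fun u hu => le_on_closure hin ?_ continuousOn_const hu
    rw [closure_Ioo (by linarith : -|s| ≠ |s|)]
    exact (hcont.mono fun u hu => ⟨by linarith [hu.1], by linarith [hu.2]⟩).norm
  exact absurd (hR y hy |s| (abs_nonneg s) hsT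
    (fun u hu => hcut u ⟨by linarith [hu.1], by linarith [hu.2]⟩ (hle u hu)) s
    ⟨neg_abs_le s, le_abs_self s⟩) (not_lt.2 hsR)

end ODE

/-! ### Newton's equation with a confining potential -/

section Newton

open Set

theorem eqOn_of_hasDerivAt_eq {E : Type*} [NormedAddCommGroup E] [NormedSpace ℝ E]
    {f g f' : ℝ → E} {I : Set ℝ} (hI : I.OrdConnected) (hf : ∀ t ∈ I, HasDerivAt f (f' t) t)
    (hg : ∀ t ∈ I, HasDerivAt g (f' t) t) {t₀ : ℝ} (ht₀ : t₀ ∈ I) (h : f t₀ = g t₀) :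
    EqOn f g I := by
  intro t ht
  have := hI.convex.norm_image_sub_le_of_norm_hasDerivWithin_le (f := f - g) (f' := fun _ => 0)
    (C := 0) (fun x hx => by simpa using ((hf x hx).sub (hg x hx)).hasDerivWithinAt)
    (fun x _ => by simp) ht₀ ht
  simpa [h, sub_eq_zero] using this

/-- The first-order system for `(s, s')` equivalent to Newton's equation `s'' = -V'(s) / 2`. -/
noncomputable def newtonField (V : ℝ → ℝ) (y : ℝ × ℝ) : ℝ × ℝ := (y.2, -deriv V y.1 / 2)

theorem contDiff_newtonField {V : ℝ → ℝ} (hV : ContDiff ℝ 2 V) : ContDiff ℝ 1 (newtonField V) := by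
  have h : ContDiff ℝ 1 (deriv V) := ((contDiff_succ_iff_deriv (n := 1)).1 hV).2.2
  unfold newtonField
  fun_prop

/-- The potential `V` prevents escape to infinity in finite time: either it is bounded below, or,
for every energy `E` and every `s₀`, there is a point `M < s₀` that the energy `E` does not reach,
to the right of which `V` is bounded below. -/
def IsConfining (V : ℝ → ℝ) : Prop :=
  ∀ E s₀ : ℝ, ∃ C, (∀ s, -C ≤ V s) ∨ ∃ M < s₀, E < V M ∧ ∀ s, M ≤ s → -C ≤ V s

/-- The energy `s' ^ 2 + V s` is conserved; with a confining potential it bounds the speed. -/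
theorem IsConfining.exists_global_solution {V : ℝ → ℝ} (hV : ContDiff ℝ 2 V) (hc : IsConfining V)
    (y₀ : ℝ × ℝ) :
    ∃ y : ℝ → ℝ × ℝ, y 0 = y₀ ∧ ∀ t, HasDerivAt y (newtonField V (y t)) t := by
  refine exists_global_solution_of_bound (contDiff_newtonField hV) y₀ fun T hT => ?_
  set E : ℝ := y₀.2 ^ 2 + V y₀.1 with hE
  obtain ⟨C, hC⟩ := hc E y₀.1
  refine ⟨|y₀.1| + (E + C + 1) * T + (E + C + 1) + 1, fun y hy τ hτ hτT hd => ?_⟩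
  have h0 : (0 : ℝ) ∈ Icc (-τ) τ := ⟨by linarith, hτ⟩
  have h1 : ∀ t ∈ Icc (-τ) τ, HasDerivAt (fun t => (y t).1) (y t).2 t := fun t ht => (hd t ht).fst
  have h2 : ∀ t ∈ Icc (-τ) τ, HasDerivAt (fun t => (y t).2) (-deriv V (y t).1 / 2) t :=
    fun t ht => (hd t ht).snd
  have hen : ∀ t ∈ Icc (-τ) τ, (y t).2 ^ 2 + V (y t).1 = E := by
    refine eqOn_of_hasDerivAt_eq (f' := fun _ => 0) ordConnected_Icc (fun t ht => ?_)
      (fun t _ => hasDerivAt_const t E) h0 (by simp [hy, hE])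
    have hV1 : HasDerivAt V (deriv V (y t).1) (y t).1 :=
      (hV.differentiable two_ne_zero _).hasDerivAt
    refine (((h2 t ht).pow 2).add (hV1.comp t (h1 t ht))).congr_deriv ?_
    push_cast
    ring
  have hlow : ∀ t ∈ Icc (-τ) τ, -C ≤ V (y t).1 := by
    rcases hC with hC | ⟨M, hM, hEM, hC⟩
    · exact fun t _ => hC _
    intro t ht
    refine hC _ ?_
    by_contra! hlt
    have hsub : uIcc 0 t ⊆ Icc (-τ) τ := ordConnected_Icc.uIcc_subset h0 ht
    obtain ⟨u, hu, hu'⟩ := intermediate_value_uIcc (f := fun t => (y t).1) (a := 0) (b := t)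
      (fun s hs => (h1 s (hsub hs)).continuousAt.continuousWithinAt)
      (mem_uIcc.2 (Or.inr ⟨hlt.le, by simpa [hy] using hM.le⟩))
    have h3 := hen u (hsub hu)
    simp only at hu'
    rw [hu'] at h3
    nlinarith [sq_nonneg (y u).2]
  have hv : ∀ t ∈ Icc (-τ) τ, |(y t).2| ≤ E + C + 1 := by
    intro t ht
    have h3 := hen t ht
    have h4 := hlow t ht
    rw [abs_le]
    constructor <;> nlinarith [sq_nonneg ((y t).2 + 1), sq_nonneg ((y t).2 - 1)]
  intro t ht
  have hD : 0 ≤ E + C + 1 := (abs_nonneg _).trans (hv t ht)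
  have hs : |(y t).1 - y₀.1| ≤ (E + C + 1) * |t| := by
    have := (convex_Icc (-τ) τ).norm_image_sub_le_of_norm_hasDerivWithin_le
      (f := fun t => (y t).1) (fun x hx => (h1 x hx).hasDerivWithinAt) hv h0 ht
    simpa [hy] using this
  have ht' : (E + C + 1) * |t| ≤ (E + C + 1) * T :=
    mul_le_mul_of_nonneg_left ((abs_le.2 ht).trans hτT.le) hD
  have hDT : 0 ≤ (E + C + 1) * T := by positivity
  have habs : |(y t).1| ≤ |(y t).1 - y₀.1| + |y₀.1| := by
    simpa using abs_add_le ((y t).1 - y₀.1) y₀.1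
  rw [Prod.norm_def, max_lt_iff, Real.norm_eq_abs, Real.norm_eq_abs]
  constructor
  · linarith
  · linarith [hv t ht, abs_nonneg y₀.1]

end Newton

/-! ### Geodesics of metrics depending on one coordinate -/

section OneVariableMetric

open Set

variable {n : ℕ} {e : Fin n} {G N : ℝ → Matrix (Fin n) (Fin n) ℝ}

/-- The entrywise derivative of a matrix-valued function of one real variable. -/
noncomputable def entryDeriv (A : ℝ → Matrix (Fin n) (Fin n) ℝ) (s : ℝ) :
    Matrix (Fin n) (Fin n) ℝ :=
  Matrix.of fun i j => deriv (fun r => A r i j) s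

theorem hasDerivAt_mulVec {A : ℝ → Matrix (Fin n) (Fin n) ℝ} {σ : ℝ → ℝ} {u : ℝ → Fin n → ℝ}
    {t σ' : ℝ} {u' : Fin n → ℝ} (hA : ∀ i j, DifferentiableAt ℝ (fun r => A r i j) (σ t))
    (hσ : HasDerivAt σ σ' t) (hu : HasDerivAt u u' t) :
    HasDerivAt (fun r => A (σ r) *ᵥ u r)
      (σ' • (entryDeriv A (σ t) *ᵥ u t) + A (σ t) *ᵥ u') t := by
  refine hasDerivAt_pi.2 fun i => ?_
  have h := HasDerivAt.fun_sum (u := Finset.univ) fun j _ =>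
    ((hA i j).hasDerivAt.comp t hσ).mul (hasDerivAt_pi.1 hu j)
  refine h.congr_deriv ?_
  simp only [Pi.add_apply, Pi.smul_apply, Matrix.mulVec, dotProduct, entryDeriv, Matrix.of_apply,
    smul_eq_mul, Finset.mul_sum, ← Finset.sum_add_distrib]
  exact Finset.sum_congr rfl fun j _ => by simp only [Function.comp_apply]; ring

/-- The components `G s` of a metric `h_s + ds²` on `ℝⁿ` that depends only on the coordinate `s` of
index `e`, together with the components `N s` of the inverse metric. -/
structure IsOneVariableMetric (e : Fin n) (G N : ℝ → Matrix (Fin n) (Fin n) ℝ) : Prop where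
  contDiff : ∀ i j, ContDiff ℝ ∞ (fun s => G s i j)
  contDiff_inv : ∀ i j, ContDiff ℝ ∞ (fun s => N s i j)
  symm : ∀ s, (G s).IsSymm
  mul_inv : ∀ s, G s * N s = 1
  row : ∀ s, G s e = Pi.single e 1

namespace IsOneVariableMetric

theorem inv_mul (h : IsOneVariableMetric e G N) (s : ℝ) : N s * G s = 1 :=
  mul_eq_one_comm.1 (h.mul_inv s)

theorem inv_eq (h : IsOneVariableMetric e G N) (s : ℝ) : (G s)⁻¹ = N s :=
  Matrix.inv_eq_right_inv (h.mul_inv s)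

theorem symm_inv (h : IsOneVariableMetric e G N) (s : ℝ) : (N s).IsSymm := by
  rw [← h.inv_eq, Matrix.IsSymm, Matrix.transpose_nonsing_inv, h.symm s]

theorem row_inv (h : IsOneVariableMetric e G N) (s : ℝ) : N s e = Pi.single e 1 := by
  have h1 := congrFun (h.mul_inv s) e
  rw [Matrix.mul_apply_eq_vecMul, h.row, Matrix.single_one_vecMul] at h1
  rw [show N s e = (N s).row e from rfl, h1]
  ext j
  simp [Matrix.one_apply, Pi.single_apply, eq_comm]

theorem mulVec_self (h : IsOneVariableMetric e G N) (s : ℝ) (w : Fin n → ℝ) :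
    (G s *ᵥ w) e = w e := by
  simp [Matrix.mulVec, h.row]

theorem inv_mulVec_self (h : IsOneVariableMetric e G N) (s : ℝ) (w : Fin n → ℝ) :
    (N s *ᵥ w) e = w e := by
  simp [Matrix.mulVec, h.row_inv]

theorem differentiable (h : IsOneVariableMetric e G N) (i j : Fin n) :
    Differentiable ℝ (fun s => G s i j) := (h.contDiff i j).differentiable (by simp)

theorem differentiable_inv (h : IsOneVariableMetric e G N) (i j : Fin n) :
    Differentiable ℝ (fun s => N s i j) := (h.contDiff_inv i j).differentiable (by simp)

/-- The derivative of the inverse matrix, `N' = -N G' N`. -/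
theorem entryDeriv_inv (h : IsOneVariableMetric e G N) (s : ℝ) :
    entryDeriv N s = -(N s * entryDeriv G s * N s) := by
  have h1 : entryDeriv G s * N s + G s * entryDeriv N s = 0 := by
    ext i j
    have h2 := HasDerivAt.fun_sum (u := Finset.univ) fun k _ =>
      (h.differentiable i k s).hasDerivAt.mul (h.differentiable_inv k j s).hasDerivAt
    have h3 : (fun r => ∑ k, G r i k * N r k j) = fun _ => (1 : Matrix (Fin n) (Fin n) ℝ) i j := by
      ext r
      rw [← h.mul_inv r, Matrix.mul_apply]
    have h4 := h2.unique (h3 ▸ hasDerivAt_const s _)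
    rw [Finset.sum_add_distrib] at h4
    simpa [Matrix.mul_apply, entryDeriv] using h4
  have h5 := congrArg (N s * ·) h1
  simp only [mul_add, mul_zero, ← mul_assoc, h.inv_mul, one_mul] at h5
  exact eq_neg_of_add_eq_zero_right h5

theorem partialDeriv_eq (h : IsOneVariableMetric e G N) (k i j : Fin n) (x : Fin n → ℝ) :
    partialDeriv k (fun y => G (y e) i j) x =
      (Pi.single e 1 : Fin n → ℝ) k * entryDeriv G (x e) i j := by
  have h1 := (h.differentiable i j (x e)).hasDerivAt.comp_hasFDerivAt x
    (ContinuousLinearMap.proj (R := ℝ) (φ := fun _ : Fin n => ℝ) e).hasFDerivAt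
  have h2 : fderiv ℝ (fun y : Fin n → ℝ => G (y e) i j) x = _ := h1.fderiv
  rw [partialDeriv, h2]
  simp [entryDeriv, Pi.single_apply, eq_comm]

/-- The acceleration of a geodesic through `x` with velocity `w`. -/
theorem neg_sum_christoffel (h : IsOneVariableMetric e G N) (x w : Fin n → ℝ) (k : Fin n) :
    -∑ i, ∑ j, christoffel (fun y => G (y e)) x k i j * w i * w j =
      (N (x e) *ᵥ (-(w e • (entryDeriv G (x e) *ᵥ w)) +
        Pi.single e (1 / 2 * (w ⬝ᵥ (entryDeriv G (x e) *ᵥ w))))) k := by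
  set D := entryDeriv G (x e) with hD
  have hsymm : ∀ i j, D i j = D j i := by
    intro i j
    simp only [hD, entryDeriv, Matrix.of_apply]
    congr 1
    ext r
    exact ((h.symm r).apply i j).symm
  have hl : ∀ l, ∑ i, ∑ j,
      ((Pi.single e 1 : Fin n → ℝ) i * D j l + (Pi.single e 1 : Fin n → ℝ) j * D i l
      - (Pi.single e 1 : Fin n → ℝ) l * D i j) * w i * w j =
      -2 * (-(w e • (D *ᵥ w)) + Pi.single e (1 / 2 * (w ⬝ᵥ (D *ᵥ w))) : Fin n → ℝ) l := by
    intro l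
    have h1 : ∑ i, ∑ j, (Pi.single e 1 : Fin n → ℝ) i * D j l * w i * w j = w e * (D *ᵥ w) l := by
      rw [Finset.sum_eq_single e (by intro b _ hb; simp [hb]) (by simp)]
      simp only [Matrix.mulVec, dotProduct, Finset.mul_sum]
      exact Finset.sum_congr rfl fun j _ => by rw [hsymm j l]; simp; ring
    have h2 : ∑ i, ∑ j, (Pi.single e 1 : Fin n → ℝ) j * D i l * w i * w j = w e * (D *ᵥ w) l := by
      rw [Finset.sum_comm, ← h1]
      exact Finset.sum_congr rfl fun i _ => Finset.sum_congr rfl fun j _ => by ring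
    have h3 : ∑ i, ∑ j, (Pi.single e 1 : Fin n → ℝ) l * D i j * w i * w j =
        (Pi.single e 1 : Fin n → ℝ) l * (w ⬝ᵥ (D *ᵥ w)) := by
      simp only [Matrix.mulVec, dotProduct, Finset.mul_sum]
      exact Finset.sum_congr rfl fun i _ => Finset.sum_congr rfl fun j _ => by ring
    have h4 : (Pi.single e (1 / 2 * (w ⬝ᵥ (D *ᵥ w))) : Fin n → ℝ) l =
        (Pi.single e 1 : Fin n → ℝ) l * (1 / 2 * (w ⬝ᵥ (D *ᵥ w))) := by
      simp [Pi.single_apply]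
    simp only [sub_mul, add_mul, Finset.sum_sub_distrib, Finset.sum_add_distrib, h1, h2, h3,
      Pi.add_apply, Pi.neg_apply, Pi.smul_apply, smul_eq_mul, h4]
    ring
  have hc : ∀ i j, christoffel (fun y => G (y e)) x k i j * w i * w j =
      ∑ l, (1 / 2 * N (x e) k l) * (((Pi.single e 1 : Fin n → ℝ) i * D j l
        + (Pi.single e 1 : Fin n → ℝ) j * D i l
        - (Pi.single e 1 : Fin n → ℝ) l * D i j) * w i * w j) := by
    intro i j
    simp only [christoffel, h.inv_eq, h.partialDeriv_eq, Finset.mul_sum, Finset.sum_mul]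
    exact Finset.sum_congr rfl fun l _ => by ring
  simp only [hc]
  rw [Finset.sum_congr rfl fun i _ => Finset.sum_comm, Finset.sum_comm]
  simp only [← Finset.mul_sum, hl]
  simp only [Matrix.mulVec, dotProduct, ← Finset.sum_neg_distrib]
  exact Finset.sum_congr rfl fun l _ => by ring

/-- The potential `h^{ij}(s) pᵢ pⱼ` of the motion along the coordinate `s`, at momentum `p`, has
derivative `-h'_{ij}(s) wᵢ wⱼ`, where `w` is any velocity whose momentum differs from `p` only in
the component `e`. -/
theorem deriv_bilin_inv (h : IsOneVariableMetric e G N) (p : Fin n → ℝ) (v s : ℝ) :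
    deriv (fun r => bilin (N r) p p) s =
      -((N s *ᵥ (p + Pi.single e v)) ⬝ᵥ
        (entryDeriv G s *ᵥ (N s *ᵥ (p + Pi.single e v)))) := by
  have h1 : HasDerivAt (fun r => bilin (N r) p p) (p ⬝ᵥ (entryDeriv N s *ᵥ p)) s := by
    have h2 := hasDerivAt_mulVec (σ := fun r => r) (u := fun _ => p) (t := s)
      (fun i j => h.differentiable_inv i j s) (hasDerivAt_id s) (hasDerivAt_const s p)
    have h3 := HasDerivAt.fun_sum (u := Finset.univ) fun i _ =>
      (hasDerivAt_pi.1 h2 i).const_mul (p i)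
    refine h3.congr_deriv ?_
    simp [dotProduct]
  have h4 : entryDeriv N s *ᵥ Pi.single e v = 0 := by
    ext i
    have : (fun r => N r i e) = fun _ => (Pi.single e 1 : Fin n → ℝ) i := by
      ext r
      rw [← h.row_inv r, (h.symm_inv r).apply]
    simp [entryDeriv, this]
  have h5 : (Pi.single e v) ᵥ* entryDeriv N s = 0 := by
    have h6 : (entryDeriv N s).IsSymm := by
      ext i j
      simp only [entryDeriv, Matrix.transpose_apply, Matrix.of_apply]
      congr 1
      ext r
      exact (h.symm_inv r).apply i j
    rw [← Matrix.mulVec_transpose, h6, h4]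
  have h6 : p ⬝ᵥ (entryDeriv N s *ᵥ p) =
      (p + Pi.single e v) ⬝ᵥ (entryDeriv N s *ᵥ (p + Pi.single e v)) := by
    rw [Matrix.mulVec_add, h4, add_zero, add_dotProduct, Matrix.dotProduct_mulVec (Pi.single e v),
      h5, zero_dotProduct, add_zero]
  rw [h1.deriv, h6, h.entryDeriv_inv, Matrix.neg_mulVec, dotProduct_neg, mul_assoc,
    ← Matrix.mulVec_mulVec, Matrix.dotProduct_mulVec, ← Matrix.mulVec_transpose, h.symm_inv s,
    ← Matrix.mulVec_mulVec]

theorem contDiff_bilin_inv (h : IsOneVariableMetric e G N) (p : Fin n → ℝ) :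
    ContDiff ℝ ∞ (fun s => bilin (N s) p p) := by
  simp only [bilin, Matrix.mulVec, dotProduct]
  exact ContDiff.sum fun i _ => contDiff_const.mul <| ContDiff.sum fun j _ =>
    (h.contDiff_inv i j).mul contDiff_const

/-- The Euler-Lagrange equations: along a geodesic all components of the momentum `G γ'` other than
`e` are conserved, and the component `e` is `γₑ'`. -/
theorem hasDerivAt_momentum (h : IsOneVariableMetric e G N) {γ : ℝ → Fin n → ℝ} {I : Set ℝ}
    (hγ : IsGeodesicOn (fun x => G (x e)) γ I) {t : ℝ} (ht : t ∈ I) :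
    HasDerivAt (fun t => G (γ t e) *ᵥ deriv γ t)
      (Pi.single e (1 / 2 * (deriv γ t ⬝ᵥ (entryDeriv G (γ t e) *ᵥ deriv γ t)))) t := by
  obtain ⟨h1, h2⟩ := hγ t ht
  have h3 := hasDerivAt_mulVec (A := G) (σ := fun t => γ t e)
    (fun i j => h.differentiable i j _) (hasDerivAt_pi.1 h1.hasDerivAt e) h2
  refine h3.congr_deriv ?_
  rw [funext fun k => h.neg_sum_christoffel (γ t) (deriv γ t) k, Matrix.mulVec_mulVec, h.mul_inv,
    Matrix.one_mulVec, add_neg_cancel_left]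

/-- A curve whose velocity is `N (p + s' ∂ₑ)`, with `p` constant and `s` a solution of Newton's
equation for the potential of `p`, is a geodesic. -/
theorem isGeodesicOn_of_hasDerivAt (h : IsOneVariableMetric e G N) (p : Fin n → ℝ) (hp : p e = 0)
    {y : ℝ → ℝ × ℝ} (hy : ∀ t, HasDerivAt y (newtonField (fun s => bilin (N s) p p) (y t)) t)
    {η : ℝ → Fin n → ℝ} (hηe : ∀ t, η t e = (y t).1)
    (hη : ∀ t, HasDerivAt η (N (y t).1 *ᵥ (p + Pi.single e (y t).2)) t) :
    IsGeodesicOn (fun x => G (x e)) η univ := by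
  intro t _
  refine ⟨(hη t).differentiableAt, ?_⟩
  have hd : deriv η = fun t => N (y t).1 *ᵥ (p + Pi.single e (y t).2) :=
    funext fun t => (hη t).deriv
  have h1 : HasDerivAt (fun t => p + Pi.single e (y t).2)
      (Pi.single e (newtonField (fun s => bilin (N s) p p) (y t)).2) t := by
    refine hasDerivAt_pi.2 fun i => ?_
    rcases eq_or_ne i e with rfl | hi
    · have h2 : HasDerivAt (fun t => (y t).2) _ t := (hy t).snd
      simpa using h2.const_add (p i)
    · simpa [hi] using hasDerivAt_const t (p i)
  have h2 := hasDerivAt_mulVec (A := N) (σ := fun t => (y t).1)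
    (fun i j => h.differentiable_inv i j _) (hy t).fst h1
  rw [funext fun k => h.neg_sum_christoffel (η t) (deriv η t) k, hd]
  refine h2.congr_deriv ?_
  simp only [newtonField, hηe, h.inv_mulVec_self, h.deriv_bilin_inv p (y t).2, h.entryDeriv_inv,
    Pi.add_apply, hp, Pi.single_eq_same, zero_add, Matrix.mulVec_add (N (y t).1) (-_)]
  congr 1
  · simp only [Matrix.neg_mulVec, Matrix.mulVec_neg, Matrix.mulVec_smul, Matrix.mulVec_mulVec,
      smul_neg, mul_assoc]
  · congr 2
    ring

/-- The metric is geodesically complete if all the potentials are confining. -/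
theorem isGeodesicallyComplete (h : IsOneVariableMetric e G N)
    (hc : ∀ p : Fin n → ℝ, p e = 0 → IsConfining (fun s => bilin (N s) p p)) :
    IsGeodesicallyComplete (fun x => G (x e)) := by
  intro I γ hIo hIc hγ
  rcases I.eq_empty_or_nonempty with rfl | ⟨t₀, ht₀⟩
  · refine ⟨fun _ => 0, fun t _ => ⟨differentiableAt_const _, ?_⟩, eqOn_empty _ _⟩
    have : (fun k => -∑ i, ∑ j, christoffel (fun x => G (x e)) 0 k i j
        * deriv (fun _ : ℝ => (0 : Fin n → ℝ)) t i * deriv (fun _ : ℝ => (0 : Fin n → ℝ)) t j)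
        = (0 : Fin n → ℝ) := by
      ext k
      simp
    rw [this]
    simpa using hasDerivAt_const t (0 : Fin n → ℝ)
  set P : ℝ → Fin n → ℝ := fun t => G (γ t e) *ᵥ deriv γ t with hP
  set p : Fin n → ℝ := Function.update (P t₀) e 0 with hp
  have hpe : p e = 0 := by simp [hp]
  -- the momentum along `γ`
  have hPp : ∀ t ∈ I, P t = p + Pi.single e (deriv γ t e) := by
    intro t ht
    ext k
    rcases eq_or_ne k e with rfl | hk
    · simp [hpe, hP, h.mulVec_self]
    · have := eqOn_of_hasDerivAt_eq (f := fun t => P t k) (g := fun _ => P t₀ k)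
        (f' := fun _ => 0) hIc
        (fun t ht => (hasDerivAt_pi.1 (h.hasDerivAt_momentum hγ ht) k).congr_deriv (by simp [hk]))
        (fun t _ => hasDerivAt_const _ _) ht₀ rfl ht
      simpa [hp, hk] using this
  have hvel : ∀ t ∈ I, deriv γ t = N (γ t e) *ᵥ (p + Pi.single e (deriv γ t e)) := by
    intro t ht
    rw [← hPp t ht, hP, Matrix.mulVec_mulVec, h.inv_mul, Matrix.one_mulVec]
  set V : ℝ → ℝ := fun s => bilin (N s) p p with hV
  have hV2 : ContDiff ℝ 2 V := mod_cast contDiff_infty.1 (h.contDiff_bilin_inv p) 2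
  have hnewton : ∀ t ∈ I, HasDerivAt (fun t => (γ t e, deriv γ t e))
      (newtonField V (γ t e, deriv γ t e)) t := by
    intro t ht
    refine (hasDerivAt_pi.1 (hγ t ht).1.hasDerivAt e).prodMk ?_
    have h1 := hasDerivAt_pi.1 (h.hasDerivAt_momentum hγ ht) e
    simp only [h.mulVec_self, Pi.single_eq_same] at h1
    refine h1.congr_deriv ?_
    rw [hV, h.deriv_bilin_inv p (deriv γ t e), ← hvel t ht]
    ring
  obtain ⟨z, hz0, hz⟩ := (hc p hpe).exists_global_solution hV2 (γ t₀ e, deriv γ t₀ e)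
  set y : ℝ → ℝ × ℝ := fun t => z (t - t₀) with hy
  have hy0 : y t₀ = (γ t₀ e, deriv γ t₀ e) := by simp [hy, hz0]
  have hyd : ∀ t, HasDerivAt y (newtonField V (y t)) t :=
    fun t => (hz (t - t₀)).comp_sub_const t t₀
  have hyγ : EqOn (fun t => (γ t e, deriv γ t e)) y I :=
    eqOn_of_hasDerivAt_of_contDiff (contDiff_newtonField hV2) hIo hIc hnewton (fun t _ => hyd t)
      ht₀ hy0.symm
  set u : ℝ → Fin n → ℝ := fun t => N (y t).1 *ᵥ (p + Pi.single e (y t).2) with hu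
  have hyc : Continuous y := continuous_iff_continuousAt.2 fun t => (hyd t).continuousAt
  have huc : Continuous u := by
    refine Continuous.matrix_mulVec (continuous_matrix fun i j => ?_) ?_
    · exact (h.contDiff_inv i j).continuous.comp hyc.fst
    · exact continuous_const.add ((continuous_single e).comp hyc.snd)
  set η : ℝ → Fin n → ℝ := fun t => γ t₀ + ∫ τ in t₀..t, u τ with hη
  have hηd : ∀ t, HasDerivAt η (u t) t :=
    fun t => (huc.integral_hasStrictDerivAt t₀ t).hasDerivAt.const_add _
  have hη0 : η t₀ = γ t₀ := by simp [hη]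
  have hηe : ∀ t, η t e = (y t).1 := by
    intro t
    refine eqOn_of_hasDerivAt_eq (f := fun t => η t e) (g := fun t => (y t).1)
      (f' := fun t => (y t).2) ordConnected_univ (fun t _ => ?_) (fun t _ => (hyd t).fst)
      (mem_univ t₀) (by simp [hη0, hy0]) (mem_univ t)
    exact (hasDerivAt_pi.1 (hηd t) e).congr_deriv (by simp [hu, h.inv_mulVec_self, hpe])
  refine ⟨η, h.isGeodesicOn_of_hasDerivAt p hpe hyd hηe hηd, ?_⟩
  refine eqOn_of_hasDerivAt_eq (f' := u) hIc (fun t _ => hηd t) (fun t ht => ?_) ht₀ hη0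
  refine (hγ t ht).1.hasDerivAt.congr_deriv ?_
  rw [hvel t ht, hu]
  simp only [← hyγ ht]

end IsOneVariableMetric

end OneVariableMetric

/-! ### The Petrov metric: block matrices, isometries and potentials -/

section Petrov

variable {m : ℕ}

/-- The block-diagonal matrix with a `2 × 2` block `!![a, b; c, d]`, the diagonal block `μ`, and a
last diagonal entry `1`. -/
noncomputable def blockMatrix (a b c d : ℝ) (μ : Fin (m + 1) → ℝ) :
    Matrix (Fin (m + 4)) (Fin (m + 4)) ℝ :=
  Matrix.diagonal (Fin.snoc (α := fun _ => ℝ) (Matrix.vecCons a (Matrix.vecCons d μ)) 1)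
    + Matrix.single 0 1 b + Matrix.single 1 0 c

theorem forall_fin_add_four {p : Fin (m + 4) → Prop} :
    (∀ i, p i) ↔
      p 0 ∧ p 1 ∧ (∀ k : Fin (m + 1), p k.succ.succ.castSucc) ∧ p (Fin.last (m + 3)) := by
  rw [Fin.forall_fin_succ', Fin.forall_fin_succ, Fin.forall_fin_succ, and_assoc, and_assoc]
  rfl

theorem last_ne_zero_fin_add_four : Fin.last (m + 3) ≠ 0 := Fin.last_pos.ne'

theorem last_ne_one_fin_add_four : Fin.last (m + 3) ≠ 1 := by
  intro h
  have h' : m + 3 = 1 := congrArg Fin.val h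
  omega

theorem succ_succ_castSucc_ne_zero (k : Fin (m + 1)) : k.succ.succ.castSucc ≠ 0 := by
  intro h
  have h' : (k : ℕ) + 2 = 0 := congrArg Fin.val h
  omega

theorem succ_succ_castSucc_ne_one (k : Fin (m + 1)) : k.succ.succ.castSucc ≠ 1 := by
  intro h
  have h' : (k : ℕ) + 2 = 1 := congrArg Fin.val h
  omega

section MulVec

variable (a b c d : ℝ) (μ : Fin (m + 1) → ℝ) (v : Fin (m + 4) → ℝ)

theorem blockMatrix_mulVec_zero : (blockMatrix a b c d μ *ᵥ v) 0 = a * v 0 + b * v 1 := by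
  simp [blockMatrix, Matrix.add_mulVec, Matrix.mulVec_diagonal, Matrix.single_mulVec]

theorem blockMatrix_mulVec_one : (blockMatrix a b c d μ *ᵥ v) 1 = c * v 0 + d * v 1 := by
  simp [blockMatrix, Matrix.add_mulVec, Matrix.mulVec_diagonal, Matrix.single_mulVec, add_comm]

theorem blockMatrix_mulVec_succ (k : Fin (m + 1)) :
    (blockMatrix a b c d μ *ᵥ v) k.succ.succ.castSucc = μ k * v k.succ.succ.castSucc := by
  simp only [blockMatrix, Matrix.add_mulVec, Pi.add_apply, Matrix.mulVec_diagonal,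
    Matrix.single_mulVec, Function.update_of_ne (succ_succ_castSucc_ne_zero k),
    Function.update_of_ne (succ_succ_castSucc_ne_one k), Fin.snoc_castSucc, Matrix.cons_val_succ,
    Pi.zero_apply, add_zero]

theorem blockMatrix_mulVec_last :
    (blockMatrix a b c d μ *ᵥ v) (Fin.last (m + 3)) = v (Fin.last (m + 3)) := by
  simp only [blockMatrix, Matrix.add_mulVec, Pi.add_apply, Matrix.mulVec_diagonal,
    Matrix.single_mulVec, Function.update_of_ne last_ne_zero_fin_add_four,
    Function.update_of_ne last_ne_one_fin_add_four, Fin.snoc_last, Pi.zero_apply, add_zero, one_mul]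

end MulVec

theorem blockMatrix_mul (a b c d a' b' c' d' : ℝ) (μ μ' : Fin (m + 1) → ℝ) :
    blockMatrix a b c d μ * blockMatrix a' b' c' d' μ' =
      blockMatrix (a * a' + b * c') (a * b' + b * d') (c * a' + d * c') (c * b' + d * d')
        (fun k => μ k * μ' k) := by
  refine Matrix.ext_of_mulVec_single fun j => ?_
  rw [← Matrix.mulVec_mulVec, funext_iff, forall_fin_add_four]
  simp only [blockMatrix_mulVec_zero, blockMatrix_mulVec_one, blockMatrix_mulVec_succ,
    blockMatrix_mulVec_last]
  exact ⟨by ring, by ring, fun k => by ring, trivial⟩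

theorem blockMatrix_one : blockMatrix 1 0 0 1 (fun _ : Fin (m + 1) => 1) = 1 := by
  refine Matrix.ext_of_mulVec_single fun j => ?_
  rw [Matrix.one_mulVec, funext_iff, forall_fin_add_four]
  simp only [blockMatrix_mulVec_zero, blockMatrix_mulVec_one, blockMatrix_mulVec_succ,
    blockMatrix_mulVec_last]
  exact ⟨by ring, by ring, fun k => by ring, trivial⟩

theorem blockMatrix_transpose (a b c d : ℝ) (μ : Fin (m + 1) → ℝ) :
    (blockMatrix a b c d μ)ᵀ = blockMatrix a c b d μ := by
  simp only [blockMatrix, Matrix.transpose_add, Matrix.diagonal_transpose, Matrix.transpose_single]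
  rw [add_right_comm]

theorem contDiff_blockMatrix {a b c d : ℝ → ℝ} {μ : ℝ → Fin (m + 1) → ℝ} (ha : ContDiff ℝ ∞ a)
    (hb : ContDiff ℝ ∞ b) (hc : ContDiff ℝ ∞ c) (hd : ContDiff ℝ ∞ d)
    (hμ : ∀ k, ContDiff ℝ ∞ (fun s => μ s k)) (i j : Fin (m + 4)) :
    ContDiff ℝ ∞ (fun s => blockMatrix (a s) (b s) (c s) (d s) (μ s) i j) := by
  have h : ∀ i, ContDiff ℝ ∞ fun s =>
      (blockMatrix (a s) (b s) (c s) (d s) (μ s) *ᵥ Pi.single j 1) i := by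
    rw [forall_fin_add_four]
    simp only [blockMatrix_mulVec_zero, blockMatrix_mulVec_one, blockMatrix_mulVec_succ,
      blockMatrix_mulVec_last]
    exact ⟨by fun_prop, by fun_prop, fun k => (hμ k).mul contDiff_const, contDiff_const⟩
  simpa using h i

/-- The components of the Petrov metric as functions of the last coordinate alone. -/
noncomputable def petrovComponents (α β : ℝ) (lam : Fin (m + 1) → ℝ) (s : ℝ) :
    Matrix (Fin (m + 4)) (Fin (m + 4)) ℝ :=
  blockMatrix (-(Real.exp (-2 * α * s) * Real.cos (2 * β * s)))
    (-(Real.exp (-2 * α * s) * Real.sin (2 * β * s)))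
    (-(Real.exp (-2 * α * s) * Real.sin (2 * β * s)))
    (Real.exp (-2 * α * s) * Real.cos (2 * β * s)) (fun k => Real.exp (-2 * lam k * s))

theorem petrovMetric_eq (α β : ℝ) (lam : Fin (m + 1) → ℝ) (x : Fin (m + 4) → ℝ) :
    petrovMetric α β lam x = petrovComponents α β lam (x (Fin.last (m + 3))) := rfl

theorem contDiff_petrovComponents (α β : ℝ) (lam : Fin (m + 1) → ℝ) (i j : Fin (m + 4)) :
    ContDiff ℝ ∞ (fun s => petrovComponents α β lam s i j) := by
  apply contDiff_blockMatrix <;> intros <;> fun_prop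

theorem petrovComponents_isSymm (α β : ℝ) (lam : Fin (m + 1) → ℝ) (s : ℝ) :
    (petrovComponents α β lam s).IsSymm := blockMatrix_transpose ..

/-- The inverse metric has the same shape: only the exponents change sign, because the
`2 × 2` block is `e^{-2αs}` times a symmetric involution. -/
theorem petrovComponents_mul (α β : ℝ) (lam : Fin (m + 1) → ℝ) (s : ℝ) :
    petrovComponents α β lam s * petrovComponents (-α) β (-lam) s = 1 := by
  rw [petrovComponents, petrovComponents, blockMatrix_mul, ← blockMatrix_one]
  have h1 : Real.exp (-2 * α * s) * Real.exp (-2 * -α * s) = 1 := by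
    rw [← Real.exp_add, Real.exp_eq_one_iff]
    ring
  have h2 : ∀ k, Real.exp (-2 * lam k * s) * Real.exp (-2 * (-lam) k * s) = 1 := by
    intro k
    rw [← Real.exp_add, Real.exp_eq_one_iff, Pi.neg_apply]
    ring
  have h3 := Real.sin_sq_add_cos_sq (2 * β * s)
  simp only [h2]
  congr 1
  · linear_combination h3 + h1 * (Real.sin (2 * β * s) ^ 2 + Real.cos (2 * β * s) ^ 2)
  · ring
  · ring
  · linear_combination h3 + h1 * (Real.sin (2 * β * s) ^ 2 + Real.cos (2 * β * s) ^ 2)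

theorem isOneVariableMetric_petrov (α β : ℝ) (lam : Fin (m + 1) → ℝ) :
    IsOneVariableMetric (Fin.last (m + 3)) (petrovComponents α β lam)
      (petrovComponents (-α) β (-lam)) where
  contDiff := contDiff_petrovComponents α β lam
  contDiff_inv := contDiff_petrovComponents (-α) β (-lam)
  symm := petrovComponents_isSymm α β lam
  mul_inv := petrovComponents_mul α β lam
  row s := by
    ext j
    have h : (petrovComponents α β lam s *ᵥ Pi.single j 1) (Fin.last (m + 3)) =
      (Pi.single j 1 : Fin (m + 4) → ℝ) (Fin.last (m + 3)) := blockMatrix_mulVec_last ..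
    simpa [Pi.single_apply, eq_comm] using h

/-- The linear map that rotates the plane of the first two coordinates by the angle `βa` and
scales it by `e^{αa}`, and scales the coordinate of index `k + 2` by `e^{λₖ a}`. -/
noncomputable def petrovFlow (α β : ℝ) (lam : Fin (m + 1) → ℝ) (a : ℝ) :
    Matrix (Fin (m + 4)) (Fin (m + 4)) ℝ :=
  blockMatrix (Real.exp (α * a) * Real.cos (β * a)) (-(Real.exp (α * a) * Real.sin (β * a)))
    (Real.exp (α * a) * Real.sin (β * a)) (Real.exp (α * a) * Real.cos (β * a))
    (fun k => Real.exp (lam k * a))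

theorem petrovFlow_mul_neg (α β : ℝ) (lam : Fin (m + 1) → ℝ) (a : ℝ) :
    petrovFlow α β lam a * petrovFlow α β lam (-a) = 1 := by
  rw [petrovFlow, petrovFlow, blockMatrix_mul, ← blockMatrix_one]
  have h1 : Real.exp (α * a) * Real.exp (α * -a) = 1 := by
    rw [← Real.exp_add, Real.exp_eq_one_iff]
    ring
  have h2 : ∀ k, Real.exp (lam k * a) * Real.exp (lam k * -a) = 1 := by
    intro k
    rw [← Real.exp_add, Real.exp_eq_one_iff]
    ring
  have h3 := Real.sin_sq_add_cos_sq (β * a)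
  simp only [h2, mul_neg β, Real.sin_neg, Real.cos_neg]
  congr 1
  · linear_combination h3 + h1 * (Real.sin (β * a) ^ 2 + Real.cos (β * a) ^ 2)
  · ring
  · ring
  · linear_combination h3 + h1 * (Real.sin (β * a) ^ 2 + Real.cos (β * a) ^ 2)

/-- The map with linear part `petrovFlow α β lam a` and shift `a` of the last coordinate preserves
the metric: with `z = x₁ + i x₂`, the first block is `-Re (e^{-2(α + iβ)s} dz²)` and the map is
`z ↦ e^{(α + iβ)a} z`. -/
theorem petrovFlow_transpose_mul_mul (α β : ℝ) (lam : Fin (m + 1) → ℝ) (a s : ℝ) :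
    (petrovFlow α β lam a)ᵀ * petrovComponents α β lam (s + a) * petrovFlow α β lam a =
      petrovComponents α β lam s := by
  rw [petrovFlow, petrovComponents, petrovComponents, blockMatrix_transpose, blockMatrix_mul,
    blockMatrix_mul]
  have h1 : Real.exp (-2 * α * (s + a)) * Real.exp (α * a) ^ 2 = Real.exp (-2 * α * s) := by
    rw [sq, ← Real.exp_add, ← Real.exp_add]
    ring_nf
  have h2 : ∀ k, Real.exp (lam k * a) * Real.exp (-2 * lam k * (s + a)) * Real.exp (lam k * a) =
      Real.exp (-2 * lam k * s) := by
    intro k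
    rw [← Real.exp_add, ← Real.exp_add]
    ring_nf
  have hθ : 2 * β * s = 2 * β * (s + a) - 2 * (β * a) := by ring
  have hc := congrArg Real.cos hθ
  have hs := congrArg Real.sin hθ
  rw [Real.cos_sub, Real.cos_two_mul', Real.sin_two_mul] at hc
  rw [Real.sin_sub, Real.cos_two_mul', Real.sin_two_mul] at hs
  simp only [h2, hc, hs, ← h1]
  congr 1 <;> ring

theorem petrovComponents_zero (α β : ℝ) (lam : Fin (m + 1) → ℝ) :
    petrovComponents α β lam 0 = Matrix.diagonal (fun i => if i = 0 then -1 else 1) := by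
  refine Matrix.ext_of_mulVec_single fun j => ?_
  rw [funext_iff, forall_fin_add_four]
  simp only [petrovComponents, blockMatrix_mulVec_zero, blockMatrix_mulVec_one,
    blockMatrix_mulVec_succ, blockMatrix_mulVec_last, Matrix.mulVec_diagonal]
  simp

theorem isUnit_det_petrovFlow (α β : ℝ) (lam : Fin (m + 1) → ℝ) (a : ℝ) :
    IsUnit (petrovFlow α β lam a).det :=
  (Matrix.isUnit_iff_isUnit_det _).1 (.of_mul_eq_one _ (petrovFlow_mul_neg α β lam a))

theorem isLorentzianMetric_petrovMetric (α β : ℝ) (lam : Fin (m + 1) → ℝ) :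
    IsLorentzianMetric (petrovMetric α β lam) where
  smooth i j := (contDiff_petrovComponents α β lam i j).comp (contDiff_apply ℝ ℝ (Fin.last (m + 3)))
  symm x := petrovComponents_isSymm ..
  signature x := by
    refine ⟨petrovFlow α β lam (x (Fin.last (m + 3))), 0, isUnit_det_petrovFlow .., ?_⟩
    rw [petrovMetric_eq, ← petrovComponents_zero α β lam, ← petrovFlow_transpose_mul_mul α β lam
      (x (Fin.last (m + 3))) 0, zero_add]

/-- The isometry taking `p` to `q` is `x ↦ L (x - p) + q`, where `L` is the flow at the
difference of the last coordinates. -/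
theorem isHomogeneousMetric_petrovMetric (α β : ℝ) (lam : Fin (m + 1) → ℝ) :
    IsHomogeneousMetric (petrovMetric α β lam) := by
  intro p q
  set a := q (Fin.last (m + 3)) - p (Fin.last (m + 3)) with ha
  set L := petrovFlow α β lam a with hL
  have h1 : L * petrovFlow α β lam (-a) = 1 := petrovFlow_mul_neg ..
  have h2 : petrovFlow α β lam (-a) * L = 1 := mul_eq_one_comm.1 h1
  have hsm : ∀ (A : Matrix (Fin (m + 4)) (Fin (m + 4)) ℝ) (p q : Fin (m + 4) → ℝ),
      ContDiff ℝ ∞ fun x => A *ᵥ (x - p) + q := fun A p q =>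
    (((Matrix.mulVecLin A).toContinuousLinearMap.contDiff).comp
      (contDiff_id.sub contDiff_const)).add contDiff_const
  refine ⟨⟨fun x => L *ᵥ (x - p) + q, fun x => petrovFlow α β lam (-a) *ᵥ (x - q) + p, ?_, ?_⟩,
    ⟨hsm _ _ _, hsm _ _ _, ?_⟩, ?_⟩
  · intro x
    simp [Matrix.mulVec_mulVec, h2]
  · intro x
    simp [Matrix.mulVec_mulVec, h1]
  · intro x v w
    have hd : fderiv ℝ (fun x => L *ᵥ (x - p) + q) x =
        (Matrix.mulVecLin L).toContinuousLinearMap := by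
      refine HasFDerivAt.fderiv (HasFDerivAt.add_const q ?_)
      simpa using ((Matrix.mulVecLin L).toContinuousLinearMap.hasFDerivAt (x := x - p)).comp x
        ((hasFDerivAt_id x).sub_const p)
    have hlast : (L *ᵥ (x - p) + q) (Fin.last (m + 3)) = x (Fin.last (m + 3)) + a := by
      simp only [hL, petrovFlow, Pi.add_apply, blockMatrix_mulVec_last, Pi.sub_apply, ha]
      ring
    simp only [Equiv.coe_fn_mk, hd, petrovMetric_eq, hlast]
    rw [← petrovFlow_transpose_mul_mul α β lam a (x _)]
    simp [bilin, ← hL, ← Matrix.mulVec_mulVec, Matrix.dotProduct_mulVec, Matrix.vecMul_transpose]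
  · simp

/-- The potential at momentum `p`. -/
theorem bilin_petrovComponents (α β : ℝ) (lam : Fin (m + 1) → ℝ) (p : Fin (m + 4) → ℝ)
    (hp : p (Fin.last (m + 3)) = 0) (s : ℝ) :
    bilin (petrovComponents (-α) β (-lam) s) p p =
      Real.exp (2 * α * s) * (Real.cos (2 * β * s) * (p 1 ^ 2 - p 0 ^ 2)
        - Real.sin (2 * β * s) * (2 * p 0 * p 1))
      + ∑ k : Fin (m + 1), Real.exp (2 * lam k * s) * p k.succ.succ.castSucc ^ 2 := by
  have h := petrovMetric_lineElement (-α) β (-lam) (fun _ => s) p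
  rw [petrovMetric_eq] at h
  rw [h, hp]
  simp only [Pi.neg_apply, mul_neg, neg_mul, neg_neg]
  ring

/-- A nonzero oscillation takes a positive value. -/
theorem exists_pos_cos_sub_sin {A B : ℝ} (h : ¬(A = 0 ∧ B = 0)) :
    ∃ θ : ℝ, 0 < Real.cos θ * A - Real.sin θ * B := by
  rcases lt_trichotomy A 0 with hA | hA | hA
  · exact ⟨Real.pi, by simpa using hA⟩
  · rcases lt_or_gt_of_ne (fun hB => h ⟨hA, hB⟩) with hB | hB
    · exact ⟨Real.pi / 2, by simpa using hB⟩
    · exact ⟨-(Real.pi / 2), by simpa using hB⟩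
  · exact ⟨0, by simpa using hA⟩

open Filter in
/-- For `α < 0` the amplitude of the oscillating term blows up as `s → -∞`, and its maxima are the
barriers; on a half-line bounded below the term is bounded. -/
theorem isConfining_petrov {α β : ℝ} (hα : α ≤ 0) (hβ : 0 < β) (A B : ℝ) {W : ℝ → ℝ}
    (hW : ∀ s, 0 ≤ W s) :
    IsConfining (fun s => Real.exp (2 * α * s) *
      (Real.cos (2 * β * s) * A - Real.sin (2 * β * s) * B) + W s) := by
  intro E s₀
  have hosc : ∀ s, -(|A| + |B|) ≤ Real.cos (2 * β * s) * A - Real.sin (2 * β * s) * B := by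
    intro s
    have h1 : |Real.cos (2 * β * s) * A| ≤ |A| := by
      rw [abs_mul]
      exact mul_le_of_le_one_left (abs_nonneg A) (Real.abs_cos_le_one _)
    have h2 : |Real.sin (2 * β * s) * B| ≤ |B| := by
      rw [abs_mul]
      exact mul_le_of_le_one_left (abs_nonneg B) (Real.abs_sin_le_one _)
    linarith [(abs_le.1 h1).1, (abs_le.1 h2).2]
  have hbound : ∀ s c, Real.exp (2 * α * s) ≤ c → -(c * (|A| + |B|)) ≤ Real.exp (2 * α * s) *
      (Real.cos (2 * β * s) * A - Real.sin (2 * β * s) * B) + W s := by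
    intro s c hc
    have h1 := mul_le_mul_of_nonneg_left (hosc s) (Real.exp_pos (2 * α * s)).le
    have h2 := mul_le_mul_of_nonneg_right hc (by positivity : 0 ≤ |A| + |B|)
    linarith [hW s]
  rcases hα.eq_or_lt with rfl | hα
  · exact ⟨1 * (|A| + |B|), Or.inl fun s => hbound s 1 (by simp)⟩
  by_cases hAB : A = 0 ∧ B = 0
  · exact ⟨0, Or.inl fun s => by simpa [hAB.1, hAB.2] using hW s⟩
  obtain ⟨θ, hθ⟩ := exists_pos_cos_sub_sin hAB
  -- the points where the phase `2βs` is congruent to `θ`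
  have hM : Tendsto (fun N : ℕ => (θ - N * (2 * Real.pi)) / (2 * β)) atTop atBot := by
    refine Tendsto.atBot_div_const (by positivity) ?_
    refine tendsto_atBot_add_const_left _ θ (tendsto_neg_atTop_atBot.comp ?_)
    exact tendsto_natCast_atTop_atTop.atTop_mul_const (by positivity)
  have hexp : Tendsto (fun N : ℕ => Real.exp (2 * α * ((θ - N * (2 * Real.pi)) / (2 * β))) *
      (Real.cos θ * A - Real.sin θ * B)) atTop atTop :=
    (Real.tendsto_exp_atTop.comp (hM.const_mul_atBot_of_neg (by linarith))).atTop_mul_const hθ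
  obtain ⟨N, hN1, hN2⟩ := ((hM.eventually_lt_atBot s₀).and (hexp.eventually_gt_atTop E)).exists
  set M := (θ - N * (2 * Real.pi)) / (2 * β) with hMdef
  have hphase : 2 * β * M = θ - N * (2 * Real.pi) := by
    rw [hMdef]
    field_simp
  refine ⟨Real.exp (2 * α * M) * (|A| + |B|), Or.inr ⟨M, hN1, ?_, fun s hs => hbound s _ ?_⟩⟩
  · simp only [hphase, Real.cos_sub_nat_mul_two_pi, Real.sin_sub_nat_mul_two_pi]
    linarith [hW M]
  · exact Real.exp_le_exp.2 (by nlinarith)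

end Petrov

theorem proposition5p1 (m : ℕ) (α β : ℝ) (lam : Fin (m + 1) → ℝ) (hα : α ≤ 0) (hβ : 0 < β) :
    IsLorentzianMetric (petrovMetric α β lam) ∧
      IsHomogeneousMetric (petrovMetric α β lam) ∧
      IsGeodesicallyComplete (petrovMetric α β lam) := by
  refine ⟨isLorentzianMetric_petrovMetric α β lam, isHomogeneousMetric_petrovMetric α β lam, ?_⟩
  refine (isOneVariableMetric_petrov α β lam).isGeodesicallyComplete fun p hp => ?_
  simp only [bilin_petrovComponents α β lam p hp]
  exact isConfining_petrov hα hβ _ _ fun s => by positivity
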